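/- (GCH implies AC, over ZF.) Let $(M,\in)$ be any model of first-order Zermelo–Fraenkel set theory $\mathsf{ZF}$ (without the axiom of choice); all notions below are interpreted in $M$. Write $x\preceq y$ if there is an injection $x\to y$, $x\approx y$ if there is a bijection, and $x\prec y$ if $x\preceq y$ and not $x\approx y$. Call a set $x$ finite if $x\approx n$ for some $n\in\omega$, and call $x$ a GCH-set if $x$ is finite or there is no set $y$ with $x\prec y$ and $y\prec\mathcal P x$. Let $\operatorname{card}(x)$ be the intersection of the class of all ordinals equinumerous to $x$, defined when this intersection is a set (that is, when there is such an ordinal). If every set is a GCH-set, then $\operatorname{card}(x)$ is defined for every set $x$ (that is, $\operatorname{dom}\operatorname{card}=V$); every set is well-orderable; and the axiom of choice holds: for every set $x$ there is a function $f$ with domain $x$ such that $f(z)\in z$ for every nonempty $z\in x$. -/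

import Mathlib

open FirstOrder

namespace SetModel

/-! ### Models of Zermelo–Fraenkel set theory without choice

Lean's own sets and types are well-orderable by `Classical.choice`, so the result is stated
for arbitrary models of first-order ZF. All notions below (finite, injection, ordinal, ...)
are internal to the model: functions and orders are elements of the model. -/

/-- The relation symbols of the language of set theory: one binary symbol. -/
inductive setRel : ℕ → Type
  | mem : setRel 2

/-- The first-order language of set theory. -/
def setLang : Language := ⟨fun _ => Empty, setRel⟩

/-- The membership symbol. -/
def memSymbol : setLang.Relations 2 := setRel.mem

section

variable {M : Type*} [setLang.Structure M]

/-- Membership in the model. -/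
def Mem (x y : M) : Prop :=
  Language.Structure.RelMap memSymbol ![x, y]

infix:50 " ∈ₘ " => Mem

/-- `x ⊆ y` in the model. -/
def Subset (x y : M) : Prop := ∀ z : M, z ∈ₘ x → z ∈ₘ y

/-- `e = ∅`. -/
def IsEmptySet (e : M) : Prop := ∀ z : M, ¬ z ∈ₘ e

/-- `p = {x, y}`. -/
def IsUPair (p x y : M) : Prop := ∀ z : M, z ∈ₘ p ↔ z = x ∨ z = y

/-- `s = x ∪ {x}`. -/
def IsSucc (s x : M) : Prop := ∀ z : M, z ∈ₘ s ↔ z ∈ₘ x ∨ z = x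

/-- `p = 𝒫 x`. -/
def IsPowerset (p x : M) : Prop := ∀ z : M, z ∈ₘ p ↔ Subset z x

/-- `w` contains `∅` and is closed under `x ↦ x ∪ {x}`. -/
def IsInductive (w : M) : Prop :=
  (∃ e : M, IsEmptySet e ∧ e ∈ₘ w) ∧
    ∀ x : M, x ∈ₘ w → ∃ s : M, IsSucc s x ∧ s ∈ₘ w

variable (M) in
/-- `M` is a model of first-order ZF (no axiom of choice). The two schemas range over the
classes and relations that are first-order definable over `M` with parameters from `M`. -/
structure IsZFModel : Prop where
  extensionality : ∀ x y : M, (∀ z : M, z ∈ₘ x ↔ z ∈ₘ y) → x = y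
  pairing : ∀ x y : M, ∃ p : M, IsUPair p x y
  union : ∀ x : M, ∃ u : M, ∀ z : M, z ∈ₘ u ↔ ∃ y : M, y ∈ₘ x ∧ z ∈ₘ y
  powerset : ∀ x : M, ∃ p : M, IsPowerset p x
  infinity : ∃ w : M, IsInductive w
  foundation : ∀ x : M, (∃ y : M, y ∈ₘ x) → ∃ y : M, y ∈ₘ x ∧ ∀ z : M, z ∈ₘ x → ¬ z ∈ₘ y
  separation : ∀ P : Set M, (Set.univ : Set M).Definable₁ setLang P →
    ∀ a : M, ∃ b : M, ∀ x : M, x ∈ₘ b ↔ x ∈ₘ a ∧ x ∈ P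
  replacement : ∀ R : Set (M × M), (Set.univ : Set M).Definable₂ setLang R →
    ∀ a : M, (∀ x : M, x ∈ₘ a → ∀ y y' : M, (x, y) ∈ R → (x, y') ∈ R → y = y') →
      ∃ b : M, ∀ y : M, y ∈ₘ b ↔ ∃ x : M, x ∈ₘ a ∧ (x, y) ∈ R

/-- `p` is the Kuratowski ordered pair `{{x}, {x, y}}`. -/
def IsOPair (p x y : M) : Prop :=
  ∃ a b : M, IsUPair a x x ∧ IsUPair b x y ∧ IsUPair p a b

/-- The ordered pair of `x` and `y` is an element of `f`. -/
def PairMem (f x y : M) : Prop := ∃ p : M, IsOPair p x y ∧ p ∈ₘ f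

/-- `f` is a function with domain `x`. -/
def IsFunctionOn (f x : M) : Prop :=
  (∀ p : M, p ∈ₘ f → ∃ u v : M, IsOPair p u v ∧ u ∈ₘ x) ∧
    ∀ u : M, u ∈ₘ x → ∃! v : M, PairMem f u v

/-- `f` is an injective function from `x` to `y`. -/
def IsInjection (f x y : M) : Prop :=
  IsFunctionOn f x ∧ (∀ u v : M, PairMem f u v → v ∈ₘ y) ∧
    ∀ u u' v : M, PairMem f u v → PairMem f u' v → u = u'

/-- `f` is a bijective function from `x` to `y`. -/
def IsBijection (f x y : M) : Prop :=
  IsInjection f x y ∧ ∀ v : M, v ∈ₘ y → ∃ u : M, PairMem f u v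

/-- `x ≼ y`. -/
def Dominated (x y : M) : Prop := ∃ f : M, IsInjection f x y

/-- `x ≈ y`. -/
def Equinumerous (x y : M) : Prop := ∃ f : M, IsBijection f x y

/-- `x ≺ y`. -/
def StrictlyDominated (x y : M) : Prop := Dominated x y ∧ ¬ Equinumerous x y

/-- `n ∈ ω`: `n` belongs to every inductive set. -/
def IsNatural (n : M) : Prop := ∀ w : M, IsInductive w → n ∈ₘ w

variable (M) in
/-- The class of finite sets: those equinumerous to an element of `ω`. -/
def finClass : Set M := {x | ∃ n : M, IsNatural n ∧ Equinumerous x n}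

variable (M) in
/-- The class of GCH-sets: `Fin ∪ {x | ∀ y, ¬ (x ≺ y ∧ y ≺ 𝒫 x)}`. -/
def gchClass : Set M :=
  finClass M ∪ {x | ∀ p : M, IsPowerset p x →
    ∀ y : M, ¬ (StrictlyDominated x y ∧ StrictlyDominated y p)}

/-- The relation `R` strictly well-orders the set `a` (in the sense of the model: every nonempty
subset of `a` which is an element of the model has a least element). -/
def WellOrders (R : M → M → Prop) (a : M) : Prop :=
  (∀ x : M, x ∈ₘ a → ¬ R x x) ∧
  (∀ x y z : M, x ∈ₘ a → y ∈ₘ a → z ∈ₘ a → R x y → R y z → R x z) ∧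
  (∀ x y : M, x ∈ₘ a → y ∈ₘ a → R x y ∨ x = y ∨ R y x) ∧
  ∀ b : M, Subset b a → (∃ x : M, x ∈ₘ b) →
    ∃ x : M, x ∈ₘ b ∧ ∀ y : M, y ∈ₘ b → y ≠ x → R x y

/-- `a` is an ordinal: a transitive set well-ordered by membership. -/
def IsOrdinal (a : M) : Prop := (∀ x : M, x ∈ₘ a → Subset x a) ∧ WellOrders Mem a

/-- `c = card x`: the set `c` is the intersection of the class of all ordinals equinumerous to
`x`. (If there is no such ordinal, the intersection is the universe, which is not a set.) -/
def IsCard (c x : M) : Prop :=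
  ∀ z : M, z ∈ₘ c ↔ ∀ a : M, IsOrdinal a → Equinumerous a x → z ∈ₘ a

variable (M) in
/-- The domain of `card`: the class of all `x` for which this intersection is a set. -/
def domCard : Set M := {x | ∃ c : M, IsCard c x}

/-- Some relation `r`, an element of the model, well-orders `x`. -/
def WellOrderable (x : M) : Prop := ∃ r : M, WellOrders (PairMem r) x

variable (M) in
/-- The axiom of choice: every set `x` has a function `f` on `x` with `f z ∈ z` for all nonempty
`z ∈ x`. -/
def AxiomOfChoice : Prop :=
  ∀ x : M, ∃ f : M, IsFunctionOn f x ∧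
    ∀ z v : M, z ∈ₘ x → (∃ t : M, t ∈ₘ z) → PairMem f z v → v ∈ₘ z

end

end SetModel

/-! This is Sierpiński's theorem, and it suffices to inject every set into an ordinal
(`exists_ordinal_dominated`). A set `x` embeds in `q = 𝒫(x ∪ w)` with `w` inductive, and `q`
contains two disjoint copies of itself, a property inherited by its power sets. Hartogs'
construction gives an ordinal `a` that does not inject into `q` but does inject into `𝒫𝒫𝒫q`.

For `r` each of `𝒫𝒫q`, `𝒫q`, `q` in turn, suppose `a ≼ 𝒫r`. A union of a copy of `r` and a copy of
`a` inside `𝒫r` lies between `r` and `𝒫r`, so by GCH an infinite `r` makes it equinumerous with one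
of them. In the first case `a ≼ r`. In the second a Cantor diagonal argument
(`Doubles.pow_dominated`) gives `𝒫r ≼ a`, hence `r ≼ a`. Since `a ≼ q` is false, some `r`, and with
it `x`, injects into an ordinal. Collapsing the range of the injection gives the cardinal; pulling
back `∈` gives well-orders and choice functions.

Separation and replacement apply only to definable classes. The predicate `Dfn` is closed under the
logical and set-theoretic operations used, so that `fun_prop` can discharge definability. -/

namespace SetModel

open Set

universe u

/-! ### Parametric definability -/

section

variable {M : Type u}

variable (M) in
/-- A type with a distinguished class of parametrically definable maps from valuations. -/
class DefSpace (β : Type*) where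
  Plot : ((ℕ → M) → β) → Prop
  const : ∀ b, Plot fun _ => b
  reindex : ∀ {f}, Plot f → ∀ σ : ℕ → ℕ, Plot fun v => f fun n => v (σ n)

instance {α β : Type*} [DefSpace M α] [DefSpace M β] : DefSpace M (α × β) where
  Plot f := DefSpace.Plot (fun v => (f v).1) ∧ DefSpace.Plot fun v => (f v).2
  const b := ⟨DefSpace.const b.1, DefSpace.const b.2⟩
  reindex hf σ := ⟨DefSpace.reindex hf.1 σ, DefSpace.reindex hf.2 σ⟩

variable (M) in
/-- A map is definable if it carries definable maps of valuations to such maps. -/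
@[fun_prop]
def Dfn {α β : Type*} [DefSpace M α] [DefSpace M β] (f : α → β) : Prop :=
  ∀ g : (ℕ → M) → α, DefSpace.Plot g → DefSpace.Plot fun v => f (g v)

section Composition

variable {α β γ δ : Type*} [DefSpace M α] [DefSpace M β] [DefSpace M γ] [DefSpace M δ]

@[fun_prop]
theorem Dfn.id : Dfn M fun x : α => x := fun _ hg => hg

@[fun_prop]
theorem Dfn.const (b : β) : Dfn M fun _ : α => b := fun _ _ => DefSpace.const b

@[fun_prop]
theorem Dfn.comp {f : β → γ} {g : α → β} (hf : Dfn M f) (hg : Dfn M g) :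
    Dfn M fun x => f (g x) :=
  fun h hh => hf _ (hg h hh)

@[fun_prop]
theorem Dfn.prodMk {f : α → β} {g : α → γ} (hf : Dfn M f) (hg : Dfn M g) :
    Dfn M fun x => (f x, g x) :=
  fun h hh => ⟨hf h hh, hg h hh⟩

@[fun_prop]
theorem Dfn.fst {f : α → β × γ} (hf : Dfn M f) : Dfn M fun x => (f x).1 :=
  fun h hh => (hf h hh).1

@[fun_prop]
theorem Dfn.snd {f : α → β × γ} (hf : Dfn M f) : Dfn M fun x => (f x).2 :=
  fun h hh => (hf h hh).2

theorem Dfn.comp₂ {f : β → γ → δ} {g : α → β} {h : α → γ}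
    (hf : Dfn M fun p : β × γ => f p.1 p.2) (hg : Dfn M g) (hh : Dfn M h) :
    Dfn M fun x => f (g x) (h x) :=
  hf.comp (g := fun x => (g x, h x)) (hg.prodMk hh)

end Composition

variable [setLang.Structure M]

/-- A set of valuations is parametrically definable. -/
def DefVal (S : (ℕ → M) → Prop) : Prop := (Set.univ : Set M).Definable setLang {v : ℕ → M | S v}

/-- Prepend a value to a valuation. -/
def consVal (y : M) (v : ℕ → M) : ℕ → M
  | 0 => y
  | n + 1 => v n

namespace DefVal

theorem congr {S T : (ℕ → M) → Prop} (h : DefVal S) (e : ∀ v, S v ↔ T v) : DefVal T := by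
  have : S = T := funext fun v => propext (e v)
  exact this ▸ h

theorem and {S T : (ℕ → M) → Prop} (hS : DefVal S) (hT : DefVal T) :
    DefVal fun v => S v ∧ T v :=
  Definable.inter hS hT

theorem not {S : (ℕ → M) → Prop} (hS : DefVal S) : DefVal fun v => ¬ S v :=
  Definable.compl hS

theorem reindex {S : (ℕ → M) → Prop} (hS : DefVal S) (σ : ℕ → ℕ) :
    DefVal fun v => S (fun n => v (σ n)) :=
  Definable.preimage_comp σ hS

theorem const (p : Prop) : DefVal (M := M) fun _ => p := by
  by_cases hp : p
  · exact congr (S := fun _ => True) definable_univ (by simp [hp])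
  · exact congr (S := fun _ => False) definable_empty (by simp [hp])

theorem exist {S : (ℕ → M) → Prop} (hS : DefVal S) :
    DefVal fun v => ∃ y, S (consVal y v) := by
  -- Index 0 reads the quantified variable and index `n + 1` reads `v n`, matching `consVal`.
  let σ : ℕ → ℕ ⊕ Unit := fun n => Nat.casesOn n (Sum.inr ()) Sum.inl
  have e : ∀ (v : ℕ → M) (u : Unit → M), Sum.elim v u ∘ σ = consVal (u ()) v := by
    intro v u
    funext n
    cases n <;> rfl
  have h := Definable.exists_of_finite (Definable.preimage_comp σ hS)
  have h' : DefVal (M := M) fun v => ∃ u : Unit → M, S (Sum.elim v u ∘ σ) := h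
  refine h'.congr fun v => ?_
  simp only [e]
  exact ⟨fun ⟨u, hu⟩ => ⟨u (), hu⟩, fun ⟨y, hy⟩ => ⟨fun _ => y, hy⟩⟩

theorem eq_var (i j : ℕ) : DefVal (M := M) fun v => v i = v j := by
  refine ⟨(Language.Term.var i).equal (Language.Term.var j), ?_⟩
  ext v
  simp

theorem mem_var (i j : ℕ) : DefVal (M := M) fun v => v i ∈ₘ v j := by
  refine ⟨((setLang.lhomWithConstants (Set.univ : Set M)).onRelation
    memSymbol).formula₂ (Language.Term.var i) (Language.Term.var j), ?_⟩
  ext v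
  rw [mem_ofPred_eq, mem_ofPred_eq, Language.Formula.realize_rel₂]
  exact iff_of_eq ((setLang.lhomWithConstants
    (Set.univ : Set M)).map_onRelation memSymbol _).symm

theorem eq_const (i : ℕ) (c : M) : DefVal (M := M) fun v => v i = c := by
  have h : (Set.univ : Set M).Definable₁ setLang {c} :=
    Definable.singleton_of_mem setLang (Set.mem_univ c)
  exact Definable.preimage_comp (fun _ : Fin 1 => i) h

end DefVal

instance : DefSpace M Prop where
  Plot := DefVal
  const := DefVal.const
  reindex := DefVal.reindex

/-- Definability is that of the graph. Index 0 holds the value; infinitely many indices leave room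
for any number of such shifts. -/
instance : DefSpace M M where
  Plot f := DefVal fun v => v 0 = f (fun n => v (n + 1))
  const b := DefVal.eq_const 0 b
  reindex {f} hf σ := by
    refine (hf.reindex (fun n => Nat.casesOn n 0 fun n => σ n + 1)).congr fun v => ?_
    rfl

section Rules

variable {α : Type*} [DefSpace M α]

@[fun_prop]
theorem Dfn.and {P Q : α → Prop} (hP : Dfn M P) (hQ : Dfn M Q) : Dfn M fun x => P x ∧ Q x :=
  fun h hh => DefVal.and (hP h hh) (hQ h hh)

@[fun_prop]
theorem Dfn.not {P : α → Prop} (hP : Dfn M P) : Dfn M fun x => ¬ P x :=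
  fun h hh => DefVal.not (hP h hh)

theorem Dfn.congr {P Q : α → Prop} (hP : Dfn M P) (e : ∀ x, P x ↔ Q x) : Dfn M Q := by
  have : P = Q := funext fun x => propext (e x)
  exact this ▸ hP

@[fun_prop]
theorem Dfn.or {P Q : α → Prop} (hP : Dfn M P) (hQ : Dfn M Q) : Dfn M fun x => P x ∨ Q x :=
  (hP.not.and hQ.not).not.congr fun _ => by tauto

@[fun_prop]
theorem Dfn.imp {P Q : α → Prop} (hP : Dfn M P) (hQ : Dfn M Q) : Dfn M fun x => P x → Q x :=
  (hP.not.or hQ).congr fun _ => by tauto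

@[fun_prop]
theorem Dfn.iff {P Q : α → Prop} (hP : Dfn M P) (hQ : Dfn M Q) : Dfn M fun x => P x ↔ Q x :=
  ((hP.imp hQ).and (hQ.imp hP)).congr fun _ => iff_def.symm

theorem plot_tail {g : (ℕ → M) → α} (hg : DefSpace.Plot g) :
    DefSpace.Plot fun v : ℕ → M => (g fun n => v (n + 1), v 0) :=
  ⟨DefSpace.reindex hg _, DefVal.eq_var (M := M) 0 1⟩

@[fun_prop]
theorem Dfn.exists {P : α → M → Prop} (hP : Dfn M fun p : α × M => P p.1 p.2) :
    Dfn M fun x => ∃ y, P x y :=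
  fun _ hg => (DefVal.exist (hP _ (plot_tail hg))).congr fun _ => Iff.rfl

@[fun_prop]
theorem Dfn.forall {P : α → M → Prop} (hP : Dfn M fun p : α × M => P p.1 p.2) :
    Dfn M fun x => ∀ y, P x y :=
  (Dfn.exists (P := fun x y => ¬ P x y) hP.not).not.congr fun _ => by push Not; rfl

theorem dfn_of_graph {f : α → M} (h : Dfn M fun p : α × M => p.2 = f p.1) : Dfn M f :=
  fun _ hg => (h _ (plot_tail hg)).congr fun _ => Iff.rfl

/-- Function values are eliminated from a formula by quantifying existentially over them, at indices
0 and 1. -/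
theorem defVal_of_plot_two {R : M → M → Prop} (hR : DefVal fun v : ℕ → M => R (v 0) (v 1))
    {f g : (ℕ → M) → M} (hf : DefSpace.Plot f) (hg : DefSpace.Plot g) :
    DefVal fun v => R (f v) (g v) := by
  have h1 : DefVal fun v => R (v 0) (v 1) ∧ v 0 = f (fun n => v (n + 2)) ∧
      v 1 = g fun n => v (n + 2) :=
    hR.and ((hf.reindex (fun n => Nat.casesOn n 0 fun n => n + 2)).and (hg.reindex (· + 1)))
  refine h1.exist.exist.congr fun v => ?_
  simp [consVal]

@[fun_prop]
theorem Dfn.mem {f g : α → M} (hf : Dfn M f) (hg : Dfn M g) : Dfn M fun x => f x ∈ₘ g x :=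
  fun h hh => defVal_of_plot_two (DefVal.mem_var 0 1) (hf h hh) (hg h hh)

@[fun_prop]
theorem Dfn.eq {f g : α → M} (hf : Dfn M f) (hg : Dfn M g) : Dfn M fun x => f x = g x :=
  fun h hh => defVal_of_plot_two (DefVal.eq_var 0 1) (hf h hh) (hg h hh)

@[fun_prop]
theorem Dfn.existsUnique {P : α → M → Prop} (hP : Dfn M fun p : α × M => P p.1 p.2) :
    Dfn M fun x => ∃! y, P x y := by
  have h2 : Dfn M fun p : (α × M) × M => P p.1.1 p.2 :=
    hP.comp (f := fun p : α × M => P p.1 p.2) (g := fun p : (α × M) × M => (p.1.1, p.2))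
      (by fun_prop)
  unfold ExistsUnique
  fun_prop

end Rules

end

/-! ### Definite descriptions and definability of the basic notions -/

section

variable {M : Type u}

open Classical in
/-- The unique element satisfying `P`, or an arbitrary fixed element. -/
noncomputable def the [Nonempty M] (P : M → Prop) : M :=
  if h : ∃! y, P y then h.choose else Classical.arbitrary M

theorem the_spec [Nonempty M] {P : M → Prop} (h : ∃! y, P y) : P (the P) := by
  rw [the, dif_pos h]
  exact h.choose_spec.1

theorem the_eq [Nonempty M] {P : M → Prop} {y : M} (hy : P y) (h : ∀ z, P z → z = y) :
    the P = y :=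
  h _ (the_spec ⟨y, hy, h⟩)

variable [setLang.Structure M] {α : Type*} [DefSpace M α]

variable (M) in
/-- A model of ZF, as a type class. -/
class ZF : Prop where
  zf : IsZFModel M

instance [ZF M] : Nonempty M :=
  let ⟨w, _⟩ := (ZF.zf (M := M)).infinity
  ⟨w⟩

section Description

@[fun_prop]
theorem Dfn.the [Nonempty M] {P : α → M → Prop} (hP : Dfn M fun p : α × M => P p.1 p.2) :
    Dfn M fun x => the (P x) := by
  apply dfn_of_graph
  have h1 : Dfn M fun p : α × M => ∃! y, P p.1 y := (Dfn.existsUnique hP).comp Dfn.id.fst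
  -- The default value is one fixed element, hence an admissible parameter.
  have h2 : Dfn M fun p : α × M =>
      ((∃! y, P p.1 y) ∧ P p.1 p.2) ∨ ((¬ ∃! y, P p.1 y) ∧ p.2 = Classical.arbitrary M) := by
    fun_prop
  refine h2.congr fun p => ?_
  by_cases h : ∃! y, P p.1 y
  · simp only [h, true_and, not_true, false_and, or_false]
    exact ⟨fun hp => h.unique hp (the_spec h), fun hp => hp ▸ the_spec h⟩
  · simp [h, SetModel.the]

end Description

section Frozen

variable {f g h : α → M}

@[fun_prop]
theorem Dfn.subset (hf : Dfn M f) (hg : Dfn M g) : Dfn M fun x => Subset (f x) (g x) := by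
  unfold Subset; fun_prop

@[fun_prop]
theorem Dfn.isUPair (hf : Dfn M f) (hg : Dfn M g) (hh : Dfn M h) :
    Dfn M fun x => IsUPair (f x) (g x) (h x) := by
  unfold IsUPair; fun_prop

@[fun_prop]
theorem Dfn.isOPair (hf : Dfn M f) (hg : Dfn M g) (hh : Dfn M h) :
    Dfn M fun x => IsOPair (f x) (g x) (h x) := by
  unfold IsOPair; fun_prop

@[fun_prop]
theorem Dfn.pairMem (hf : Dfn M f) (hg : Dfn M g) (hh : Dfn M h) :
    Dfn M fun x => PairMem (f x) (g x) (h x) := by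
  unfold PairMem; fun_prop

@[fun_prop]
theorem Dfn.isFunctionOn (hf : Dfn M f) (hg : Dfn M g) :
    Dfn M fun x => IsFunctionOn (f x) (g x) := by
  unfold IsFunctionOn; fun_prop

@[fun_prop]
theorem Dfn.isInjection (hf : Dfn M f) (hg : Dfn M g) (hh : Dfn M h) :
    Dfn M fun x => IsInjection (f x) (g x) (h x) := by
  unfold IsInjection; fun_prop

@[fun_prop]
theorem Dfn.isBijection (hf : Dfn M f) (hg : Dfn M g) (hh : Dfn M h) :
    Dfn M fun x => IsBijection (f x) (g x) (h x) := by
  unfold IsBijection; fun_prop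

@[fun_prop]
theorem Dfn.equinumerous (hf : Dfn M f) (hg : Dfn M g) :
    Dfn M fun x => Equinumerous (f x) (g x) := by
  unfold Equinumerous; fun_prop

@[fun_prop]
theorem Dfn.isOrdinal (hf : Dfn M f) : Dfn M fun x => IsOrdinal (f x) := by
  unfold IsOrdinal WellOrders; fun_prop

end Frozen

theorem definable₁_of_dfn {P : M → Prop} (hP : Dfn M P) :
    (Set.univ : Set M).Definable₁ setLang {x | P x} :=
  have h : DefVal fun v : ℕ → M => P (v 0) := hP (fun v => v 0) (DefVal.eq_var 0 1)
  Definable.preimage_comp (fun _ : ℕ => (0 : Fin 1)) h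

theorem definable₂_of_dfn {R : M → M → Prop} (hR : Dfn M fun p : M × M => R p.1 p.2) :
    (Set.univ : Set M).Definable₂ setLang {p : M × M | R p.1 p.2} := by
  have h : DefVal fun v : ℕ → M => R (v 0) (v 1) :=
    hR (fun v => (v 0, v 1)) ⟨DefVal.eq_var 0 1, DefVal.eq_var 0 2⟩
  rw [Definable₂]
  convert Definable.preimage_comp (fun n : ℕ => if n = 0 then (0 : Fin 2) else 1) h using 1
  ext v
  simp

/-! ### Set operations from the axioms -/

variable [ZF M]

theorem ext_set {x y : M} (h : ∀ z : M, z ∈ₘ x ↔ z ∈ₘ y) : x = y :=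
  (ZF.zf (M := M)).extensionality x y h

theorem Subset.antisymm {x y : M} (h : Subset x y) (h' : Subset y x) : x = y :=
  ext_set fun z => ⟨h z, h' z⟩

/-- An element of `M` with prescribed elements. -/
noncomputable def setOfMem (P : M → Prop) : M := the fun b => ∀ z : M, z ∈ₘ b ↔ P z

theorem mem_setOfMem {P : M → Prop} (h : ∃ b : M, ∀ z : M, z ∈ₘ b ↔ P z) {z : M} :
    z ∈ₘ setOfMem P ↔ P z := by
  obtain ⟨b, hb⟩ := h
  exact the_spec (P := fun b => ∀ z : M, z ∈ₘ b ↔ P z)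
    ⟨b, hb, fun c hc => ext_set fun z => (hc z).trans (hb z).symm⟩ z

@[fun_prop]
theorem Dfn.setOfMem {P : α → M → Prop} (hP : Dfn M fun p : α × M => P p.1 p.2) :
    Dfn M fun x => setOfMem (P x) := by
  unfold SetModel.setOfMem
  have h : Dfn M fun p : (α × M) × M => P p.1.1 p.2 := hP.comp₂ (by fun_prop) (by fun_prop)
  fun_prop

/-- `{x, y}`. -/
noncomputable def upair (x y : M) : M := setOfMem fun z => z = x ∨ z = y

/-- `⋃ x`. -/
noncomputable def sUnion (x : M) : M := setOfMem fun z => ∃ y : M, y ∈ₘ x ∧ z ∈ₘ y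

/-- `𝒫 x`. -/
noncomputable def pow (x : M) : M := setOfMem fun z => Subset z x

/-- `{z ∈ x | P z}`. -/
noncomputable def sep (x : M) (P : M → Prop) : M := setOfMem fun z => z ∈ₘ x ∧ P z

/-- `{F z | z ∈ x}`. -/
noncomputable def image (F : M → M) (x : M) : M := setOfMem fun y => ∃ z : M, z ∈ₘ x ∧ y = F z

/-- `x ∪ y`. -/
noncomputable def union (x y : M) : M := sUnion (upair x y)

/-- `x ∪ {y}`. -/
noncomputable def insert (y x : M) : M := union x (upair y y)

/-- The ordered pair of `x` and `y`. -/
noncomputable def opair (x y : M) : M := upair (upair x x) (upair x y)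

section Spec

variable {x y z : M}

@[simp]
theorem mem_upair : z ∈ₘ upair x y ↔ z = x ∨ z = y :=
  mem_setOfMem ((ZF.zf (M := M)).pairing x y)

@[simp]
theorem mem_sUnion : z ∈ₘ sUnion x ↔ ∃ y : M, y ∈ₘ x ∧ z ∈ₘ y :=
  mem_setOfMem ((ZF.zf (M := M)).union x)

@[simp]
theorem mem_pow : z ∈ₘ pow x ↔ Subset z x :=
  mem_setOfMem ((ZF.zf (M := M)).powerset x)

theorem mem_sep {P : M → Prop} (hP : Dfn M P) : z ∈ₘ sep x P ↔ z ∈ₘ x ∧ P z :=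
  mem_setOfMem ((ZF.zf (M := M)).separation _ (definable₁_of_dfn hP) x)

theorem exists_replacement {R : M → M → Prop} (hR : Dfn M fun p : M × M => R p.1 p.2)
    (h : ∀ z : M, z ∈ₘ x → ∀ y y' : M, R z y → R z y' → y = y') :
    ∃ b : M, ∀ y : M, y ∈ₘ b ↔ ∃ z : M, z ∈ₘ x ∧ R z y :=
  (ZF.zf (M := M)).replacement _ (definable₂_of_dfn hR) x h

theorem mem_image {F : M → M} (hF : Dfn M F) : y ∈ₘ image F x ↔ ∃ z : M, z ∈ₘ x ∧ y = F z :=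
  mem_setOfMem (exists_replacement (R := fun z y => y = F z) (by fun_prop)
    fun _ _ _ _ h h' => h.trans h'.symm)

theorem mem_image_of_mem {F : M → M} (hF : Dfn M F) (hz : z ∈ₘ x) : F z ∈ₘ image F x :=
  (mem_image hF).2 ⟨z, hz, rfl⟩

@[simp]
theorem mem_union : z ∈ₘ union x y ↔ z ∈ₘ x ∨ z ∈ₘ y := by
  simp [union]

@[simp]
theorem mem_insert : z ∈ₘ insert y x ↔ z ∈ₘ x ∨ z = y := by
  simp [insert]

theorem foundation (h : ∃ y : M, y ∈ₘ x) : ∃ y : M, y ∈ₘ x ∧ ∀ z : M, z ∈ₘ x → ¬ z ∈ₘ y :=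
  (ZF.zf (M := M)).foundation x h

theorem mem_irrefl (x : M) : ¬ x ∈ₘ x := by
  obtain ⟨y, hy, h⟩ := foundation (x := upair x x) ⟨x, by simp⟩
  obtain rfl : y = x := by simpa using hy
  exact h y hy

theorem mem_asymm (h : x ∈ₘ y) : ¬ y ∈ₘ x := by
  intro h'
  obtain ⟨z, hz, hm⟩ := foundation (x := upair x y) ⟨x, by simp⟩
  rcases mem_upair.1 hz with rfl | rfl
  · exact hm y (by simp) h'
  · exact hm x (by simp) h

theorem not_mem_cycle (h : x ∈ₘ y) (h' : y ∈ₘ z) : ¬ z ∈ₘ x := by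
  intro h''
  obtain ⟨t, ht, hm⟩ := foundation (x := insert z (upair x y)) ⟨x, by simp⟩
  rcases mem_insert.1 ht with ht | rfl
  · rcases mem_upair.1 ht with rfl | rfl
    · exact hm z (by simp) h''
    · exact hm x (by simp) h
  · exact hm y (by simp) h'

theorem upair_self_inj (h : upair x x = upair y y) : x = y := by
  have : x ∈ₘ upair y y := h ▸ mem_upair.2 (Or.inl rfl)
  simpa using this

theorem opair_inj {x' y' : M} : opair x y = opair x' y' ↔ x = x' ∧ y = y' := by
  refine ⟨fun h => ?_, fun ⟨h, h'⟩ => h ▸ h' ▸ rfl⟩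
  have h1 : ∀ z : M, (z = upair x x ∨ z = upair x y) ↔ (z = upair x' x' ∨ z = upair x' y') := by
    intro z
    rw [← mem_upair, ← mem_upair]
    exact iff_of_eq (congrArg (z ∈ₘ ·) h)
  have key : ∀ a b c d : M, upair a b = upair c d → (c = a ∨ c = b) ∧ (d = a ∨ d = b) ∧
      (a = c ∨ a = d) ∧ (b = c ∨ b = d) := by
    intro a b c d e
    refine ⟨mem_upair.1 (e ▸ ?_), mem_upair.1 (e ▸ ?_), mem_upair.1 (e ▸ ?_),
      mem_upair.1 (e ▸ ?_)⟩ <;> simp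
  have hx : x = x' := by
    rcases (h1 (upair x x)).1 (Or.inl rfl) with e | e <;> have := key _ _ _ _ e <;> tauto
  subst hx
  refine ⟨rfl, ?_⟩
  have e1 := (h1 (upair x y)).1 (Or.inr rfl)
  have e2 := (h1 (upair x y')).2 (Or.inr rfl)
  rcases e1 with e1 | e1 <;> rcases e2 with e2 | e2 <;> have k1 := key _ _ _ _ e1 <;>
    have k2 := key _ _ _ _ e2 <;> grind

end Spec

section Rules

variable {f g : α → M}

@[fun_prop]
theorem Dfn.upair (hf : Dfn M f) (hg : Dfn M g) : Dfn M fun x => upair (f x) (g x) := by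
  unfold SetModel.upair; fun_prop

@[fun_prop]
theorem Dfn.sUnion (hf : Dfn M f) : Dfn M fun x => sUnion (f x) := by
  unfold SetModel.sUnion; fun_prop

@[fun_prop]
theorem Dfn.sep {P : α → M → Prop} (hf : Dfn M f) (hP : Dfn M fun p : α × M => P p.1 p.2) :
    Dfn M fun x => sep (f x) (P x) := by
  unfold SetModel.sep; fun_prop

@[fun_prop]
theorem Dfn.image {F : α → M → M} (hF : Dfn M fun p : α × M => F p.1 p.2) (hf : Dfn M f) :
    Dfn M fun x => image (F x) (f x) := by
  unfold SetModel.image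
  have h : Dfn M fun p : (α × M) × M => F p.1.1 p.2 := hF.comp₂ (by fun_prop) (by fun_prop)
  fun_prop

@[fun_prop]
theorem Dfn.union (hf : Dfn M f) (hg : Dfn M g) : Dfn M fun x => union (f x) (g x) := by
  unfold SetModel.union; fun_prop

@[fun_prop]
theorem Dfn.insert (hf : Dfn M f) (hg : Dfn M g) : Dfn M fun x => insert (f x) (g x) := by
  unfold SetModel.insert; fun_prop

@[fun_prop]
theorem Dfn.opair (hf : Dfn M f) (hg : Dfn M g) : Dfn M fun x => opair (f x) (g x) := by
  unfold SetModel.opair; fun_prop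

end Rules

end

section

variable {M : Type u} [setLang.Structure M] [ZF M]

/-! ### Internal functions and definable injections -/

section InternalFunctions

theorem isUPair_iff {p x y : M} : IsUPair p x y ↔ p = upair x y :=
  ⟨fun h => ext_set fun z => (h z).trans mem_upair.symm, fun h _ => h ▸ mem_upair⟩

theorem isOPair_iff {p x y : M} : IsOPair p x y ↔ p = opair x y := by
  simp only [IsOPair, isUPair_iff, opair]
  exact ⟨fun ⟨a, b, ha, hb, h⟩ => ha ▸ hb ▸ h, fun h => ⟨_, _, rfl, rfl, h⟩⟩

theorem pairMem_iff {f x y : M} : PairMem f x y ↔ opair x y ∈ₘ f := by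
  simp [PairMem, isOPair_iff]

/-- The value of the internal function `f` at `x`. -/
noncomputable def app (f x : M) : M := the (PairMem f x)

@[fun_prop]
theorem Dfn.app {α : Type*} [DefSpace M α] {f g : α → M} (hf : Dfn M f) (hg : Dfn M g) :
    Dfn M fun x => app (f x) (g x) := by
  unfold SetModel.app; fun_prop

/-- The restriction of `F` to `a` as an internal function. -/
noncomputable def lam (a : M) (F : M → M) : M := image (fun x => opair x (F x)) a

variable {F : M → M} {a b f x y : M}

theorem pairMem_lam (hF : Dfn M F) : PairMem (lam a F) x y ↔ x ∈ₘ a ∧ y = F x := by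
  rw [pairMem_iff, lam, mem_image (by fun_prop)]
  constructor
  · rintro ⟨z, hz, e⟩
    obtain ⟨rfl, rfl⟩ := opair_inj.1 e
    exact ⟨hz, rfl⟩
  · rintro ⟨hx, rfl⟩
    exact ⟨x, hx, rfl⟩

theorem app_lam (hF : Dfn M F) (hx : x ∈ₘ a) : app (lam a F) x = F x :=
  the_eq ((pairMem_lam hF).2 ⟨hx, rfl⟩) fun _ h => ((pairMem_lam hF).1 h).2

theorem isFunctionOn_lam (hF : Dfn M F) : IsFunctionOn (lam a F) a := by
  refine ⟨fun p hp => ?_, fun u hu => ⟨F u, (pairMem_lam hF).2 ⟨hu, rfl⟩, fun v hv =>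
    ((pairMem_lam hF).1 hv).2⟩⟩
  obtain ⟨z, hz, e⟩ := (mem_image (by fun_prop)).1 hp
  exact ⟨z, F z, isOPair_iff.2 e, hz⟩

theorem IsFunctionOn.pairMem_app (hf : IsFunctionOn f a) (hx : x ∈ₘ a) :
    PairMem f x (app f x) :=
  the_spec (hf.2 x hx)

theorem IsFunctionOn.mem_of_pairMem (hf : IsFunctionOn f a) (h : PairMem f x y) : x ∈ₘ a := by
  obtain ⟨p, hp, hpf⟩ := h
  obtain ⟨u, v, huv, hu⟩ := hf.1 p hpf
  rw [isOPair_iff] at hp huv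
  rw [(opair_inj.1 (hp.symm.trans huv)).1]
  exact hu

theorem IsFunctionOn.eq_app (hf : IsFunctionOn f a) (h : PairMem f x y) : y = app f x :=
  (hf.2 x (hf.mem_of_pairMem h)).unique h (hf.pairMem_app (hf.mem_of_pairMem h))

/-- The definable map `F` restricts to an injection from `a` to `b`. -/
structure Emb (F : M → M) (a b : M) : Prop where
  dfn : Dfn M F
  maps : ∀ {x}, x ∈ₘ a → F x ∈ₘ b
  inj : ∀ {x y}, x ∈ₘ a → y ∈ₘ a → F x = F y → x = y

theorem Emb.isInjection (h : Emb F a b) : IsInjection (lam a F) a b := by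
  refine ⟨isFunctionOn_lam h.dfn, fun u v huv => ?_, fun u u' v huv huv' => ?_⟩
  · obtain ⟨hu, rfl⟩ := (pairMem_lam h.dfn).1 huv
    exact h.maps hu
  · obtain ⟨hu, rfl⟩ := (pairMem_lam h.dfn).1 huv
    obtain ⟨hu', e⟩ := (pairMem_lam h.dfn).1 huv'
    exact h.inj hu hu' e

theorem IsInjection.emb (h : IsInjection f a b) : Emb (app f) a b where
  dfn := by fun_prop
  maps hx := h.2.1 _ _ (h.1.pairMem_app hx)
  inj hx hy e := h.2.2 _ _ _ (h.1.pairMem_app hx) (e ▸ h.1.pairMem_app hy)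

/-- By replacement a definable injection is an element of `M`, so cardinal comparisons can be made
with definable maps. -/
theorem dominated_iff : Dominated a b ↔ ∃ F : M → M, Emb F a b :=
  ⟨fun ⟨_, hf⟩ => ⟨_, hf.emb⟩, fun ⟨_, hF⟩ => ⟨_, hF.isInjection⟩⟩

theorem Emb.dominated (h : Emb F a b) : Dominated a b := dominated_iff.2 ⟨F, h⟩

theorem equinumerous_iff :
    Equinumerous a b ↔ ∃ F : M → M, Emb F a b ∧ ∀ y, y ∈ₘ b → ∃ x, x ∈ₘ a ∧ F x = y := by
  constructor
  · rintro ⟨f, hf, hs⟩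
    refine ⟨_, hf.emb, fun y hy => ?_⟩
    obtain ⟨x, hx⟩ := hs y hy
    exact ⟨x, hf.1.mem_of_pairMem hx, (hf.1.eq_app hx).symm⟩
  · rintro ⟨F, hF, hs⟩
    refine ⟨_, hF.isInjection, fun y hy => ?_⟩
    obtain ⟨x, hx, rfl⟩ := hs y hy
    exact ⟨x, (pairMem_lam hF.dfn).2 ⟨hx, rfl⟩⟩

/-- The inverse of `F` restricted to `a`. -/
noncomputable def invOn (F : M → M) (a y : M) : M := the fun x => x ∈ₘ a ∧ F x = y

theorem dfn_invOn (hF : Dfn M F) : Dfn M (invOn F a) := by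
  unfold invOn; fun_prop

theorem Emb.invOn_apply (h : Emb F a b) (hx : x ∈ₘ a) : invOn F a (F x) = x :=
  the_eq ⟨hx, rfl⟩ fun _ ⟨hz, e⟩ => h.inj hz hx e

omit [ZF M] in
theorem Emb.comp {G : M → M} {c : M} (hG : Emb G b c) (hF : Emb F a b) :
    Emb (fun x => G (F x)) a c where
  dfn := hG.dfn.comp hF.dfn
  maps hx := hG.maps (hF.maps hx)
  inj hx hy e := hF.inj hx hy (hG.inj (hF.maps hx) (hF.maps hy) e)

theorem Emb.invOn (h : Emb F a b) {c : M} (hc : ∀ y, y ∈ₘ c → ∃ x, x ∈ₘ a ∧ F x = y) :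
    Emb (invOn F a) c a where
  dfn := dfn_invOn h.dfn
  maps hy := by
    obtain ⟨x, hx, rfl⟩ := hc _ hy
    rwa [h.invOn_apply hx]
  inj hy hz e := by
    obtain ⟨x, hx, rfl⟩ := hc _ hy
    obtain ⟨x', hx', rfl⟩ := hc _ hz
    rw [h.invOn_apply hx, h.invOn_apply hx'] at e
    rw [e]

theorem Dominated.trans {c : M} (h : Dominated a b) (h' : Dominated b c) : Dominated a c := by
  obtain ⟨F, hF⟩ := dominated_iff.1 h
  obtain ⟨G, hG⟩ := dominated_iff.1 h'
  exact (hG.comp hF).dominated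

theorem Equinumerous.symm (h : Equinumerous a b) : Equinumerous b a := by
  obtain ⟨F, hF, hs⟩ := equinumerous_iff.1 h
  exact equinumerous_iff.2 ⟨_, hF.invOn hs, fun x hx => ⟨F x, hF.maps hx, hF.invOn_apply hx⟩⟩

omit [ZF M] in
theorem Equinumerous.dominated (h : Equinumerous a b) : Dominated a b := by
  obtain ⟨f, hf, -⟩ := h
  exact ⟨f, hf⟩

theorem Dominated.of_subset (h : Subset a b) : Dominated a b :=
  Emb.dominated (F := fun x => x) ⟨by fun_prop, fun hx => h _ hx, fun _ _ e => e⟩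

theorem emb_singleton : Emb (fun x : M => upair x x) a (pow a) where
  dfn := by fun_prop
  maps hx := mem_pow.2 fun z hz => by
    obtain rfl : z = _ := by simpa using hz
    exact hx
  inj _ _ e := upair_self_inj e

theorem Emb.equinumerous_image (h : Emb F a b) : Equinumerous a (image F a) :=
  equinumerous_iff.2 ⟨F, ⟨h.dfn, mem_image_of_mem h.dfn, h.inj⟩, fun _ hy =>
    let ⟨x, hx, e⟩ := (mem_image h.dfn).1 hy
    ⟨x, hx, e.symm⟩⟩

end InternalFunctions

/-! ### Ordinals -/

section Ordinals

variable {a b : M}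

/-- Foundation excludes short `∈`-cycles and supplies minimal elements; linearity turns these into
transitivity of `∈` and least elements. -/
theorem isOrdinal_iff : IsOrdinal a ↔ (∀ x : M, x ∈ₘ a → Subset x a) ∧
    ∀ x y : M, x ∈ₘ a → y ∈ₘ a → x ∈ₘ y ∨ x = y ∨ y ∈ₘ x := by
  refine ⟨fun h => ⟨h.1, h.2.2.2.1⟩, fun ⟨ht, hl⟩ => ⟨ht, fun x _ => mem_irrefl x, ?_, hl, ?_⟩⟩
  · intro x y z hx hy hz hxy hyz
    rcases hl x z hx hz with h | rfl | h
    · exact h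
    · exact absurd hxy (mem_asymm hyz)
    · exact absurd h (not_mem_cycle hxy hyz)
  · intro c hc hne
    obtain ⟨x, hx, hm⟩ := foundation hne
    refine ⟨x, hx, fun y hy hyx => ?_⟩
    have := hl x y (hc _ hx) (hc _ hy)
    have := hm y hy
    grind

omit [ZF M] in
theorem IsOrdinal.trans (h : IsOrdinal a) {x y : M} (hx : x ∈ₘ y) (hy : y ∈ₘ a) : x ∈ₘ a :=
  h.1 y hy x hx

theorem IsOrdinal.mem (h : IsOrdinal a) (hb : b ∈ₘ a) : IsOrdinal b := by
  have hl := (isOrdinal_iff.1 h).2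
  refine isOrdinal_iff.2 ⟨fun y hy z hz => ?_, fun x y hx hy => hl x y (h.trans hx hb)
    (h.trans hy hb)⟩
  rcases hl z b (h.trans hz (h.trans hy hb)) hb with h' | rfl | h'
  · exact h'
  · exact absurd hy (mem_asymm hz)
  · exact absurd h' (not_mem_cycle hz hy)

/-- An `∈`-minimal element of `a \ c` is equal to `c`. -/
theorem IsOrdinal.mem_of_ssubset (ha : IsOrdinal a) {c : M} (hc : ∀ x : M, x ∈ₘ c → Subset x c)
    (hca : Subset c a) (hne : c ≠ a) : c ∈ₘ a := by
  have hd : ∃ y : M, y ∈ₘ sep a (fun y => ¬ y ∈ₘ c) := by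
    by_contra hcon
    push Not at hcon
    refine hne (hca.antisymm fun y hy => ?_)
    by_contra hyc
    exact hcon y ((mem_sep (by fun_prop)).2 ⟨hy, hyc⟩)
  obtain ⟨x, hx, hm⟩ := foundation hd
  obtain ⟨hxa, hxc⟩ := (mem_sep (by fun_prop)).1 hx
  have : x = c := by
    refine Subset.antisymm (fun z hz => ?_) fun z hz => ?_
    · by_contra hzc
      exact hm z ((mem_sep (by fun_prop)).2 ⟨ha.trans hz hxa, hzc⟩) hz
    · rcases (isOrdinal_iff.1 ha).2 z x (hca z hz) hxa with h | rfl | h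
      · exact h
      · exact absurd hz hxc
      · exact absurd (hc z hz x h) hxc
  exact this ▸ hxa

/-- Were `a ∩ b` proper in both `a` and `b`, it would belong to both, hence to itself. -/
theorem IsOrdinal.trichotomy (ha : IsOrdinal a) (hb : IsOrdinal b) :
    a ∈ₘ b ∨ a = b ∨ b ∈ₘ a := by
  have hP : Dfn M fun z : M => z ∈ₘ b := by fun_prop
  have hc : ∀ x : M, x ∈ₘ sep a (· ∈ₘ b) → Subset x (sep a (· ∈ₘ b)) := fun x hx z hz => by
    rw [mem_sep hP] at hx ⊢
    exact ⟨ha.trans hz hx.1, hb.trans hz hx.2⟩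
  have ha' : Subset (sep a (· ∈ₘ b)) a := fun z hz => ((mem_sep hP).1 hz).1
  have hb' : Subset (sep a (· ∈ₘ b)) b := fun z hz => ((mem_sep hP).1 hz).2
  by_cases h1 : sep a (· ∈ₘ b) = a
  · by_cases h2 : sep a (· ∈ₘ b) = b
    · exact Or.inr (Or.inl (h1.symm.trans h2))
    · exact Or.inl (h1 ▸ hb.mem_of_ssubset hc hb' h2)
  · by_cases h2 : sep a (· ∈ₘ b) = b
    · exact Or.inr (Or.inr (by rw [← h2]; exact ha.mem_of_ssubset hc ha' h1))
    · exact absurd ((mem_sep hP).2 ⟨ha.mem_of_ssubset hc ha' h1, hb.mem_of_ssubset hc hb' h2⟩)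
        (mem_irrefl _)

theorem isOrdinal_of_transitive (ht : ∀ x : M, x ∈ₘ a → Subset x a)
    (ho : ∀ x : M, x ∈ₘ a → IsOrdinal x) : IsOrdinal a :=
  isOrdinal_iff.2 ⟨ht, fun x y hx hy => (ho x hx).trichotomy (ho y hy)⟩

theorem ordinal_induction {P : M → Prop} (hP : Dfn M P)
    (h : ∀ a : M, IsOrdinal a → (∀ b : M, b ∈ₘ a → P b) → P a) (ha : IsOrdinal a) : P a := by
  refine h a ha fun b hb => ?_
  by_contra hPb
  obtain ⟨x, hx, hm⟩ := foundation (x := sep a fun x => ¬ P x)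
    ⟨b, (mem_sep (by fun_prop)).2 ⟨hb, hPb⟩⟩
  obtain ⟨hxa, hxP⟩ := (mem_sep (by fun_prop)).1 hx
  refine hxP (h x (ha.mem hxa) fun y hy => ?_)
  by_contra hPy
  exact hm y ((mem_sep (by fun_prop)).2 ⟨ha.trans hy hxa, hPy⟩) hy

theorem IsOrdinal.insert_self (ha : IsOrdinal a) : IsOrdinal (insert a a) := by
  refine isOrdinal_of_transitive (fun x hx z hz => ?_) fun x hx => ?_
  · rcases mem_insert.1 hx with hx | rfl
    · exact mem_insert.2 (Or.inl (ha.trans hz hx))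
    · exact mem_insert.2 (Or.inl hz)
  · rcases mem_insert.1 hx with hx | rfl
    · exact ha.mem hx
    · exact ha

/-- The ordinals in an inductive set form an inductive set. -/
theorem IsNatural.isOrdinal {n : M} (hn : IsNatural n) : IsOrdinal n := by
  obtain ⟨w, ⟨e, he, hew⟩, hs⟩ := (ZF.zf (M := M)).infinity
  have hP : Dfn M fun x : M => IsOrdinal x := by fun_prop
  refine ((mem_sep hP).1 (hn (sep w IsOrdinal) ⟨⟨e, he, (mem_sep hP).2 ⟨hew, ?_⟩⟩,
    fun x hx => ?_⟩)).2
  · exact isOrdinal_of_transitive (fun x hx => absurd hx (he x)) fun x hx => absurd hx (he x)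
  · obtain ⟨hxw, hxo⟩ := (mem_sep hP).1 hx
    obtain ⟨s, hsx, hsw⟩ := hs x hxw
    obtain rfl : s = insert x x := ext_set fun z => (hsx z).trans mem_insert.symm
    exact ⟨_, hsx, (mem_sep hP).2 ⟨hsw, hxo.insert_self⟩⟩

end Ordinals

/-! ### Enumerations by ordinals and uniqueness of order types -/

section Enumerations

/-- `G` is an isomorphism from `(a, ∈)` onto `(c, lt)`. -/
def Enum (lt : M → M → Prop) (G : M → M) (a c : M) : Prop :=
  (∀ y : M, y ∈ₘ c ↔ ∃ x : M, x ∈ₘ a ∧ y = G x) ∧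
    ∀ x y : M, x ∈ₘ a → y ∈ₘ a → (x ∈ₘ y ↔ lt (G x) (G y))

variable {lt : M → M → Prop} {G H : M → M} {a b c : M}

theorem dfn_exists_enum (hlt : Dfn M fun p : M × M => lt p.1 p.2) {α : Type*} [DefSpace M α]
    {f g : α → M} (hf : Dfn M f) (hg : Dfn M g) :
    Dfn M fun x => ∃ h, Enum lt (app h) (f x) (g x) := by
  unfold Enum
  have : Dfn M fun p : (((α × M) × M) × M) => lt (app p.1.1.2 p.1.2) (app p.1.1.2 p.2) :=
    hlt.comp₂ (by fun_prop) (by fun_prop)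
  fun_prop

omit [ZF M] in
theorem Enum.mem (h : Enum lt G a c) {x : M} (hx : x ∈ₘ a) : G x ∈ₘ c := (h.1 _).2 ⟨x, hx, rfl⟩

theorem Enum.inj (hlt : ∀ x, ¬ lt x x) (ha : IsOrdinal a) (h : Enum lt G a c) {x y : M}
    (hx : x ∈ₘ a) (hy : y ∈ₘ a) (e : G x = G y) : x = y := by
  rcases (isOrdinal_iff.1 ha).2 x y hx hy with h' | h' | h'
  · exact absurd (e ▸ (h.2 x y hx hy).1 h') (hlt _)
  · exact h'
  · exact absurd (e ▸ (h.2 y x hy hx).1 h') (hlt _)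

omit [ZF M] in
theorem Enum.congr (h : Enum lt G a c) (e : ∀ x, x ∈ₘ a → H x = G x) : Enum lt H a c := by
  refine ⟨fun y => (h.1 y).trans (exists_congr fun x => and_congr_right fun hx => by rw [e x hx]),
    fun x y hx hy => ?_⟩
  rw [e x hx, e y hy]
  exact h.2 x y hx hy

/-- Quantifying over enumerations stays first-order when they are elements of `M`, so definable ones
are turned into sets. -/
theorem Enum.lam (hG : Dfn M G) (h : Enum lt G a c) : Enum lt (app (lam a G)) a c :=
  h.congr fun _ hx => app_lam hG hx

theorem Enum.restrict (hG : Dfn M G) (ha : IsOrdinal a) (h : Enum lt G a c) (hb : b ∈ₘ a) :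
    Enum lt G b (image G b) :=
  ⟨fun _ => mem_image hG, fun x y hx hy => h.2 x y (ha.trans hx hb) (ha.trans hy hb)⟩

theorem Enum.subset_of_enum (hlt : ∀ x, ¬ lt x x) (hG : Dfn M G) (hH : Dfn M H)
    (ha : IsOrdinal a) (hb : IsOrdinal b) (h : Enum lt G a c) (h' : Enum lt H b c) :
    Subset a b := by
  suffices ∀ x, IsOrdinal x → x ∈ₘ a → x ∈ₘ b ∧ G x = H x from
    fun x hx => (this x (ha.mem hx) hx).1
  have hP : Dfn M fun x : M => x ∈ₘ a → x ∈ₘ b ∧ G x = H x := by fun_prop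
  refine fun x => ordinal_induction hP fun x _ ih hx => ?_
  -- `H` takes the value `G x` at `y`. By induction `G` and `H` agree below `x`, so `x` and `y` have
  -- the same elements.
  obtain ⟨y, hy, e⟩ := (h'.1 (G x)).1 (h.mem hx)
  have hxy : x = y := by
    refine Subset.antisymm (fun z hz => ?_) fun z hz => ?_
    · have hza := ha.trans hz hx
      obtain ⟨hzb, ez⟩ := ih z hz hza
      rw [h'.2 z y hzb hy, ← e, ← ez]
      exact (h.2 z x hza hx).1 hz
    · have hzb := hb.trans hz hy
      obtain ⟨z', hz', ez⟩ := (h.1 (H z)).1 (h'.mem hzb)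
      have hz'x : z' ∈ₘ x := by
        rw [h.2 z' x hz' hx, ← ez, e]
        exact (h'.2 z y hzb hy).1 hz
      obtain ⟨hz'b, ez'⟩ := ih z' hz'x hz'
      rwa [h'.inj hlt hb hzb hz'b (ez.trans ez')]
  subst hxy
  exact ⟨hy, e⟩

theorem Enum.unique (hlt : ∀ x, ¬ lt x x) (hG : Dfn M G) (hH : Dfn M H)
    (ha : IsOrdinal a) (hb : IsOrdinal b) (h : Enum lt G a c) (h' : Enum lt H b c) : a = b :=
  (h.subset_of_enum hlt hG hH ha hb h').antisymm (h'.subset_of_enum hlt hH hG hb ha h)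

end Enumerations

/-! ### Hartogs' theorem -/

section Hartogs

/-- Proper inclusion. -/
def SSubset (x y : M) : Prop := Subset x y ∧ x ≠ y

omit [ZF M] in
theorem dfn_ssubset : Dfn M fun p : M × M => SSubset p.1 p.2 := by
  unfold SSubset; fun_prop

omit [ZF M] in
theorem not_ssubset_self (x : M) : ¬ SSubset x x := fun h => h.2 rfl

/-- The images of the elements of `a` grow strictly, since `G u` is new in the image of `v` when `u
∈ v`. An order type is thus coded by a chain of subsets of `p`, without ordered pairs. -/
theorem enum_image {G : M → M} {a p : M} (ha : IsOrdinal a) (hG : Emb G a p) :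
    Enum SSubset (image G) a (image (image G) a) := by
  have hd := hG.dfn
  refine ⟨fun _ => mem_image (by fun_prop), fun x y hx hy => ?_⟩
  have hss : ∀ {u v : M}, v ∈ₘ a → u ∈ₘ v → SSubset (image G u) (image G v) := by
    intro u v hv huv
    refine ⟨fun z hz => ?_, fun e => ?_⟩
    · obtain ⟨t, ht, rfl⟩ := (mem_image hd).1 hz
      exact mem_image_of_mem hd ((ha.mem hv).trans ht huv)
    · have hmem : G u ∈ₘ image G u := e ▸ mem_image_of_mem hd huv
      obtain ⟨t, ht, e'⟩ := (mem_image hd).1 hmem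
      have hu := ha.trans huv hv
      exact mem_irrefl u ((hG.inj hu (ha.trans ht hu) e').symm ▸ ht)
  refine ⟨hss hy, fun h => ?_⟩
  rcases (isOrdinal_iff.1 ha).2 x y hx hy with h' | rfl | h'
  · exact h'
  · exact absurd h (not_ssubset_self _)
  · exact absurd (h.1.antisymm (hss hx h').1) h.2

/-- Hartogs: every set has an ordinal which does not inject into it, but which injects into an
iterated power set. -/
theorem exists_hartogs (p : M) :
    ∃ a : M, IsOrdinal a ∧ ¬ Dominated a p ∧ Dominated a (pow (pow (pow p))) := by
  have hE : ∀ {α : Type u} [DefSpace M α] {f g : α → M}, Dfn M f → Dfn M g →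
      Dfn M fun x => ∃ h, Enum SSubset (app h) (f x) (g x) := dfn_exists_enum dfn_ssubset
  have hE₂ : Dfn M fun q : M × M => ∃ h, Enum SSubset (app h) q.2 q.1 := hE (by fun_prop)
    (by fun_prop)
  -- `a` collects the order types of those families of subsets of `p` that proper inclusion
  -- well-orders.
  obtain ⟨a, ha⟩ := exists_replacement (x := pow (pow p))
    (R := fun c b => IsOrdinal b ∧ ∃ h, Enum SSubset (app h) b c) (by fun_prop)
    fun c _ b b' ⟨hb, h, hh⟩ ⟨hb', h', hh'⟩ =>
      hh.unique not_ssubset_self (by fun_prop) (by fun_prop) hb hb' hh'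
  have hao : IsOrdinal a := by
    refine isOrdinal_of_transitive (fun b hb x hx => ?_) fun b hb => ?_
    · obtain ⟨c, hc, hbo, h, hh⟩ := (ha b).1 hb
      have hres := hh.restrict (by fun_prop) hbo hx
      refine (ha x).2 ⟨_, mem_pow.2 fun z hz => ?_, hbo.mem hx, h, hres⟩
      obtain ⟨t, ht, rfl⟩ := (hres.1 z).1 hz
      exact mem_pow.1 hc _ (hh.mem (hbo.trans ht hx))
    · obtain ⟨c, -, hbo, -⟩ := (ha b).1 hb
      exact hbo
  refine ⟨a, hao, fun hdom => ?_, ?_⟩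
  · obtain ⟨G, hG⟩ := dominated_iff.1 hdom
    have hd := hG.dfn
    -- The chain of images under an injection `a → p` has order type `a`, which would put `a` in
    -- itself.
    refine mem_irrefl a ((ha a).2 ⟨image (image G) a, ?_, hao, _,
      (enum_image hao hG).lam (by fun_prop)⟩)
    refine mem_pow.2 fun z hz => mem_pow.2 fun t ht => ?_
    obtain ⟨x, hx, rfl⟩ := (mem_image (by fun_prop)).1 hz
    obtain ⟨y, hy, rfl⟩ := (mem_image hd).1 ht
    exact hG.maps (hao.trans hy hx)
  · have hE' : ∀ b : M, Dfn M fun c : M => ∃ h, Enum SSubset (app h) b c := fun b =>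
      hE (by fun_prop) (by fun_prop)
    have hE₂' : Dfn M fun q : M × M => ∃ h, Enum SSubset (app h) q.1 q.2 := hE (by fun_prop)
      (by fun_prop)
    -- An ordinal goes to the set of all families of that type; one common family already determines
    -- the ordinal.
    refine Emb.dominated
      (F := fun b => sep (pow (pow p)) fun c => ∃ h, Enum SSubset (app h) b c)
      ⟨by fun_prop, fun _ => mem_pow.2 fun z hz => ((mem_sep (hE' _)).1 hz).1,
        fun {b b'} hb hb' e => ?_⟩
    obtain ⟨c, hc, hbo, hh⟩ := (ha b).1 hb
    have hmem := (mem_sep (hE' b)).2 ⟨hc, hh⟩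
    rw [e] at hmem
    obtain ⟨h, hh⟩ := hh
    obtain ⟨h', hh'⟩ := ((mem_sep (hE' b')).1 hmem).2
    exact hh.unique not_ssubset_self (by fun_prop) (by fun_prop) hbo (hao.mem hb') hh'

end Hartogs

/-! ### Collapsing sets of ordinals -/

section Collapse

/-- An isomorphism carries predecessors to predecessors. Hence each element of an order type is the
order type of a shorter segment of `b`. -/
theorem Enum.restrict_sep {G : M → M} {b y z x : M} (hG : Dfn M G) (hy : IsOrdinal y)
    (hz : IsOrdinal z) (h : Enum Mem G y (sep z (· ∈ₘ b))) (hx : x ∈ₘ y) :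
    Enum Mem G x (sep (G x) (· ∈ₘ b)) := by
  have hb : Dfn M (· ∈ₘ b) := by fun_prop
  have hres := h.restrict hG hy hx
  refine ⟨fun v => ?_, hres.2⟩
  rw [mem_sep hb]
  constructor
  · rintro ⟨hv, hvb⟩
    obtain ⟨t, ht, rfl⟩ := (h.1 v).1
      ((mem_sep hb).2 ⟨hz.trans hv ((mem_sep hb).1 (h.mem hx)).1, hvb⟩)
    exact ⟨t, (h.2 t x ht hx).2 hv, rfl⟩
  · rintro ⟨t, ht, rfl⟩
    have hty := hy.trans ht hx
    exact ⟨(h.2 t x hty hx).1 ht, ((mem_sep hb).1 (h.mem hty)).2⟩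

/-- Mostowski collapse for sets of ordinals. -/
theorem exists_enum_sep (b : M) {y : M} (hy : IsOrdinal y) :
    ∃ x, IsOrdinal x ∧ ∃ h, Enum Mem (app h) x (sep y (· ∈ₘ b)) := by
  have hmem : Dfn M fun p : M × M => p.1 ∈ₘ p.2 := by fun_prop
  have hE : Dfn M fun p : M × M => ∃ h, Enum Mem (app h) p.2 (sep p.1 (· ∈ₘ b)) :=
    dfn_exists_enum hmem (by fun_prop) (by fun_prop)
  have hb : Dfn M (· ∈ₘ b) := by fun_prop
  refine ordinal_induction (P := fun y => ∃ x, IsOrdinal x ∧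
    ∃ h, Enum Mem (app h) x (sep y (· ∈ₘ b))) (by fun_prop) (fun y hy ih => ?_) hy
  -- `ot z` is the order type of `z ∩ b`. The order type of `y ∩ b` will be the set of all `ot z`
  -- with `z ∈ y ∩ b`, enumerated by the inverse of `ot`.
  let ot : M → M := fun z => the fun x => IsOrdinal x ∧ ∃ h, Enum Mem (app h) x (sep z (· ∈ₘ b))
  have hot : Dfn M ot := by fun_prop
  have ot_eq : ∀ {z x h : M}, IsOrdinal x → Enum Mem (app h) x (sep z (· ∈ₘ b)) → ot z = x :=
    fun hx hh => the_eq ⟨hx, _, hh⟩ fun x' ⟨hx', h', hh'⟩ =>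
      hh'.unique mem_irrefl (by fun_prop) (by fun_prop) hx' hx hh
  have ot_spec : ∀ {z : M}, z ∈ₘ y →
      IsOrdinal (ot z) ∧ ∃ h, Enum Mem (app h) (ot z) (sep z (· ∈ₘ b)) := by
    intro z hz
    obtain ⟨x, hx, h, hh⟩ := ih z hz
    rw [ot_eq hx hh]
    exact ⟨hx, h, hh⟩
  have ot_mem : ∀ {z x : M}, z ∈ₘ y → x ∈ₘ ot z → ∃ u, u ∈ₘ z ∧ u ∈ₘ b ∧ ot u = x := by
    intro z x hz hx
    obtain ⟨ho, h, hh⟩ := ot_spec hz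
    obtain ⟨hu, hub⟩ := (mem_sep hb).1 (hh.mem hx)
    exact ⟨_, hu, hub, ot_eq (ho.mem hx) (hh.restrict_sep (by fun_prop) ho (hy.mem hz) hx)⟩
  have ot_lt : ∀ {u z : M}, z ∈ₘ y → u ∈ₘ b → u ∈ₘ z → ot u ∈ₘ ot z := by
    intro u z hz hub huz
    obtain ⟨ho, h, hh⟩ := ot_spec hz
    obtain ⟨x, hx, rfl⟩ := (hh.1 u).1 ((mem_sep hb).2 ⟨huz, hub⟩)
    rwa [ot_eq (ho.mem hx) (hh.restrict_sep (by fun_prop) ho (hy.mem hz) hx)]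
  have ot_inj : ∀ {u z : M}, u ∈ₘ y → z ∈ₘ y → u ∈ₘ b → z ∈ₘ b → ot u = ot z → u = z := by
    intro u z hu hz hub hzb e
    rcases (isOrdinal_iff.1 hy).2 u z hu hz with h | h | h
    · exact absurd (e ▸ ot_lt hz hub h) (mem_irrefl _)
    · exact h
    · exact absurd (e ▸ ot_lt hu hzb h) (mem_irrefl _)
  have hemb : Emb ot (sep y (· ∈ₘ b)) (image ot (sep y (· ∈ₘ b))) :=
    ⟨hot, mem_image_of_mem hot, fun hu hz => ot_inj ((mem_sep hb).1 hu).1 ((mem_sep hb).1 hz).1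
      ((mem_sep hb).1 hu).2 ((mem_sep hb).1 hz).2⟩
  refine ⟨image ot (sep y (· ∈ₘ b)), isOrdinal_of_transitive ?_ ?_, _,
    Enum.lam (dfn_invOn hot (a := sep y (· ∈ₘ b))) ⟨fun z => ⟨fun hz => ?_, ?_⟩, ?_⟩⟩
  · intro x hx t ht
    obtain ⟨z, hz, rfl⟩ := (mem_image hot).1 hx
    have hzy := ((mem_sep hb).1 hz).1
    obtain ⟨u, hu, hub, rfl⟩ := ot_mem hzy ht
    exact mem_image_of_mem hot ((mem_sep hb).2 ⟨hy.trans hu hzy, hub⟩)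
  · intro x hx
    obtain ⟨z, hz, rfl⟩ := (mem_image hot).1 hx
    exact (ot_spec ((mem_sep hb).1 hz).1).1
  · exact ⟨ot z, mem_image_of_mem hot hz, (hemb.invOn_apply hz).symm⟩
  · rintro ⟨x, hx, rfl⟩
    obtain ⟨u, hu, rfl⟩ := (mem_image hot).1 hx
    rwa [hemb.invOn_apply hu]
  · intro x x' hx hx'
    obtain ⟨u, hu, rfl⟩ := (mem_image hot).1 hx
    obtain ⟨z, hz, rfl⟩ := (mem_image hot).1 hx'
    rw [hemb.invOn_apply hu, hemb.invOn_apply hz]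
    obtain ⟨huy, hub⟩ := (mem_sep hb).1 hu
    obtain ⟨hzy, hzb⟩ := (mem_sep hb).1 hz
    refine ⟨fun h => ?_, ot_lt hzy hub⟩
    rcases (isOrdinal_iff.1 hy).2 u z huy hzy with h' | rfl | h'
    · exact h'
    · exact absurd h (mem_irrefl _)
    · exact absurd (ot_lt huy hzb h') (mem_asymm h)

theorem exists_ordinal_equinumerous {x a : M} (ha : IsOrdinal a) (h : Dominated x a) :
    ∃ c : M, IsOrdinal c ∧ Equinumerous c x := by
  obtain ⟨F, hF⟩ := dominated_iff.1 h
  have hP : Dfn M (· ∈ₘ image F x) := by fun_prop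
  obtain ⟨c, hc, g, hg⟩ := exists_enum_sep (image F x) ha
  have hs : sep a (· ∈ₘ image F x) = image F x := ext_set fun z => by
    rw [mem_sep hP, and_iff_right_iff_imp]
    intro hz
    obtain ⟨t, ht, rfl⟩ := (mem_image hF.dfn).1 hz
    exact hF.maps ht
  rw [hs] at hg
  have hsurj : ∀ z, z ∈ₘ image F x → ∃ t, t ∈ₘ x ∧ F t = z := fun z hz =>
    let ⟨t, ht, e⟩ := (mem_image hF.dfn).1 hz
    ⟨t, ht, e.symm⟩
  have hge : Emb (app g) c (image F x) := ⟨by fun_prop, hg.mem, hg.inj mem_irrefl hc⟩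
  refine ⟨c, hc, equinumerous_iff.2 ⟨_, (hF.invOn hsurj).comp hge, fun t ht => ?_⟩⟩
  obtain ⟨s, hs, e⟩ := (hg.1 (F t)).1 (mem_image_of_mem hF.dfn ht)
  exact ⟨s, hs, by rw [← e, hF.invOn_apply ht]⟩

end Collapse

/-! ### Sets containing two disjoint copies of themselves -/

section Doubling

variable {F G : M → M} {a b q : M}

theorem Emb.image (hF : Emb F a b) : Emb (image F) (pow a) (pow b) := by
  have hd := hF.dfn
  have key : ∀ {x y : M}, x ∈ₘ pow a → y ∈ₘ pow a → SetModel.image F x = SetModel.image F y →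
      Subset x y := by
    intro x y hx hy e z hz
    have hm := mem_image_of_mem hd hz
    rw [e] at hm
    obtain ⟨t, ht, e'⟩ := (mem_image hd).1 hm
    rwa [hF.inj (mem_pow.1 hx z hz) (mem_pow.1 hy t ht) e']
  refine ⟨by fun_prop, fun hx => mem_pow.2 fun z hz => ?_, fun hx hy e =>
    (key hx hy e).antisymm (key hy hx e.symm)⟩
  obtain ⟨t, ht, rfl⟩ := (mem_image hd).1 hz
  exact hF.maps (mem_pow.1 hx t ht)

/-- `F` and `G` inject the disjoint union of two copies of `q` into `q`. -/
structure Doubles (F G : M → M) (q : M) : Prop where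
  left : Emb F q q
  right : Emb G q q
  disjoint : ∀ {x y}, x ∈ₘ q → y ∈ₘ q → F x ≠ G y

/-- The missed point `e` is a tag: images under `F` omit it, so adding it yields a disjoint second
copy. -/
theorem Emb.doubles_pow {e : M} (hF : Emb F q q) (he : e ∈ₘ q) (hne : ∀ x, x ∈ₘ q → F x ≠ e) :
    Doubles (SetModel.image F) (fun x => insert e (SetModel.image F x)) (pow q) := by
  have hd := hF.dfn
  have hI := hF.image
  have hnot : ∀ {x}, x ∈ₘ pow q → ¬ e ∈ₘ SetModel.image F x := fun hx h => by
    obtain ⟨t, ht, e'⟩ := (mem_image hd).1 h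
    exact hne t (mem_pow.1 hx t ht) e'.symm
  refine ⟨hI, ⟨by fun_prop, fun hx => mem_pow.2 fun z hz => ?_, fun {x y} hx hy h => ?_⟩,
    fun hx _ h => hnot hx (h ▸ mem_insert.2 (Or.inr rfl))⟩
  · rcases mem_insert.1 hz with hz | rfl
    · exact mem_pow.1 (hI.maps hx) z hz
    · exact he
  · refine hI.inj hx hy (ext_set fun z => ?_)
    have hz : z ∈ₘ insert e (SetModel.image F x) ↔ z ∈ₘ insert e (SetModel.image F y) := by rw [h]
    rw [mem_insert, mem_insert] at hz
    constructor
    · intro h'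
      rcases hz.1 (Or.inl h') with h'' | rfl
      · exact h''
      · exact absurd h' (hnot hx)
    · intro h'
      rcases hz.2 (Or.inl h') with h'' | rfl
      · exact h''
      · exact absurd h' (hnot hy)

theorem Doubles.pow {x : M} (h : Doubles F G q) (hx : x ∈ₘ q) :
    Doubles (SetModel.image F) (fun y => insert (G x) (SetModel.image F y)) (pow q) :=
  h.left.doubles_pow (h.right.maps hx) fun _ hy => h.disjoint hy hx

/-- The pairing map on subsets of `q` given by two disjoint copies of `q` in `q`. -/
noncomputable def pairing (F G : M → M) (x y : M) : M :=
  union (SetModel.image F x) (SetModel.image G y)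

namespace Doubles

variable {x y x' y' : M}

theorem pairing_mem (h : Doubles F G q) (hx : x ∈ₘ SetModel.pow q) (hy : y ∈ₘ SetModel.pow q) :
    pairing F G x y ∈ₘ SetModel.pow q :=
  mem_pow.2 fun z hz => by
    rcases mem_union.1 hz with hz | hz
    · exact mem_pow.1 (h.left.image.maps hx) z hz
    · exact mem_pow.1 (h.right.image.maps hy) z hz

theorem mem_pairing_left {t : M} (h : Doubles F G q) (hx : x ∈ₘ SetModel.pow q)
    (hy : y ∈ₘ SetModel.pow q) (ht : t ∈ₘ q) : F t ∈ₘ pairing F G x y ↔ t ∈ₘ x := by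
  rw [pairing, mem_union, mem_image h.left.dfn, mem_image h.right.dfn]
  constructor
  · rintro (⟨z, hz, e⟩ | ⟨z, hz, e⟩)
    · rwa [h.left.inj ht (mem_pow.1 hx z hz) e]
    · exact absurd e (h.disjoint ht (mem_pow.1 hy z hz))
  · exact fun h => Or.inl ⟨t, h, rfl⟩

theorem mem_pairing_right {t : M} (h : Doubles F G q) (hx : x ∈ₘ SetModel.pow q)
    (hy : y ∈ₘ SetModel.pow q) (ht : t ∈ₘ q) : G t ∈ₘ pairing F G x y ↔ t ∈ₘ y := by
  rw [pairing, mem_union, mem_image h.left.dfn, mem_image h.right.dfn]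
  constructor
  · rintro (⟨z, hz, e⟩ | ⟨z, hz, e⟩)
    · exact absurd e.symm (h.disjoint (mem_pow.1 hx z hz) ht)
    · rwa [h.right.inj ht (mem_pow.1 hy z hz) e]
  · exact fun h => Or.inr ⟨t, h, rfl⟩

/-- The components are recovered as the preimages of the union under `F` and `G`. -/
theorem pairing_inj (h : Doubles F G q) (hx : x ∈ₘ SetModel.pow q) (hy : y ∈ₘ SetModel.pow q)
    (hx' : x' ∈ₘ SetModel.pow q) (hy' : y' ∈ₘ SetModel.pow q)
    (e : pairing F G x y = pairing F G x' y') : x = x' ∧ y = y' := by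
  have eq_of : ∀ {u v : M}, u ∈ₘ SetModel.pow q → v ∈ₘ SetModel.pow q →
      (∀ t, t ∈ₘ q → (t ∈ₘ u ↔ t ∈ₘ v)) → u = v := fun hu hv H =>
    ext_set fun t => ⟨fun ht => (H t (mem_pow.1 hu t ht)).1 ht,
      fun ht => (H t (mem_pow.1 hv t ht)).2 ht⟩
  refine ⟨eq_of hx hx' fun t ht => ?_, eq_of hy hy' fun t ht => ?_⟩
  · rw [← h.mem_pairing_left hx hy ht, e, h.mem_pairing_left hx' hy' ht]
  · rw [← h.mem_pairing_right hx hy ht, e, h.mem_pairing_right hx' hy' ht]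

end Doubles

/-- Every set injects into a nonempty set which contains two disjoint copies of itself. -/
theorem exists_doubles (x : M) : ∃ (q : M) (F G : M → M) (e : M),
    Dominated x q ∧ Doubles F G q ∧ e ∈ₘ q := by
  obtain ⟨w, ⟨e, he, hew⟩, hs⟩ := (ZF.zf (M := M)).infinity
  -- The successor on `w` and the identity elsewhere: an injection of `x ∪ w` into itself that
  -- misses `∅`.
  let σ : M → M := fun z => the fun y => (z ∈ₘ w ∧ y = insert z z) ∨ (¬ z ∈ₘ w ∧ y = z)
  have hσ : Dfn M σ := by fun_prop
  have σ_pos : ∀ {z}, z ∈ₘ w → σ z = insert z z := fun hz =>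
    the_eq (Or.inl ⟨hz, rfl⟩) fun y hy => by tauto
  have σ_neg : ∀ {z}, ¬ z ∈ₘ w → σ z = z := fun hz =>
    the_eq (Or.inr ⟨hz, rfl⟩) fun y hy => by tauto
  have succ_mem : ∀ {z}, z ∈ₘ w → insert z z ∈ₘ w := by
    intro z hz
    obtain ⟨s, hsz, hsw⟩ := hs z hz
    rwa [show insert z z = s from ext_set fun t => mem_insert.trans (hsz t).symm]
  have succ_inj : ∀ {y z : M}, insert y y = insert z z → y = z := by
    intro y z h
    have h1 : y ∈ₘ insert z z := h ▸ mem_insert.2 (Or.inr rfl)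
    have h2 : z ∈ₘ insert y y := h ▸ mem_insert.2 (Or.inr rfl)
    rcases mem_insert.1 h1 with h1 | h1
    · rcases mem_insert.1 h2 with h2 | h2
      · exact absurd h1 (mem_asymm h2)
      · exact h2.symm
    · exact h1
  have hemb : Emb σ (union x w) (union x w) := by
    refine ⟨hσ, fun {z} hz => ?_, fun {y z} _ _ h => ?_⟩
    · by_cases hzw : z ∈ₘ w
      · rw [σ_pos hzw]
        exact mem_union.2 (Or.inr (succ_mem hzw))
      · rwa [σ_neg hzw]
    · by_cases hyw : y ∈ₘ w <;> by_cases hzw : z ∈ₘ w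
      · rw [σ_pos hyw, σ_pos hzw] at h
        exact succ_inj h
      · rw [σ_pos hyw, σ_neg hzw] at h
        exact absurd (h ▸ succ_mem hyw) hzw
      · rw [σ_neg hyw, σ_pos hzw] at h
        exact absurd (h ▸ succ_mem hzw) hyw
      · rwa [σ_neg hyw, σ_neg hzw] at h
  have hmiss : ∀ z, z ∈ₘ union x w → σ z ≠ e := by
    rintro z - h
    by_cases hzw : z ∈ₘ w
    · rw [σ_pos hzw] at h
      exact he z (h ▸ mem_insert.2 (Or.inr rfl))
    · rw [σ_neg hzw] at h
      exact hzw (h ▸ hew)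
  -- `e = ∅` serves twice: as the point missed by `σ`, and as a subset of `x ∪ w`, hence an element
  -- of `q`.
  exact ⟨pow (union x w), _, _, e,
    (Dominated.of_subset fun z hz => mem_union.2 (Or.inl hz)).trans emb_singleton.dominated,
    hemb.doubles_pow (mem_union.2 (Or.inr hew)) hmiss, mem_pow.2 fun z hz => absurd hz (he z)⟩

end Doubling

/-! ### The diagonal argument and the use of GCH -/

section GCH

variable {F G L R H : M → M} {a b q : M}

/-- If `𝒫 q` injects into a union of an image of `q` and a copy of `a`, then it injects into `a`. -/
theorem Doubles.pow_dominated (h : Doubles F G q) (hL : Dfn M L) (hR : Emb R a b)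
    (hH : Emb H (SetModel.pow q) (union (image L q) (image R a))) :
    Dominated (SetModel.pow q) a := by
  have hF := h.left.dfn
  have hG := h.right.dfn
  have hRd := hR.dfn
  have hHd := hH.dfn
  have hJ : Dfn M fun p : M × M => pairing F G p.1 p.2 := by unfold pairing; fun_prop
  have hJ' : Dfn M fun p : (M × M) × M => H (pairing F G p.1.2 p.2) := by
    unfold pairing; fun_prop
  have hP : Dfn M fun t : M => ∃ S T, (S ∈ₘ SetModel.pow q ∧ T ∈ₘ SetModel.pow q) ∧
      H (pairing F G S T) = L t ∧ ¬ t ∈ₘ S := by fun_prop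
  -- Cantor's diagonal set. If `H (pairing F G D T) = L t`, injectivity makes `D` the only possible
  -- `S`, so `t ∈ D` exactly when `t ∉ D`. Hence `T ↦ H (pairing F G D T)` avoids the image of `q`.
  obtain ⟨D, hD⟩ : ∃ D, ∀ t, t ∈ₘ D ↔ t ∈ₘ q ∧ ∃ S T,
      (S ∈ₘ SetModel.pow q ∧ T ∈ₘ SetModel.pow q) ∧ H (pairing F G S T) = L t ∧ ¬ t ∈ₘ S :=
    ⟨_, fun _ => mem_sep hP⟩
  have hDq : D ∈ₘ SetModel.pow q := mem_pow.2 fun t ht => ((hD t).1 ht).1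
  have key : ∀ T, T ∈ₘ SetModel.pow q → H (pairing F G D T) ∈ₘ image R a := by
    intro T hT
    rcases mem_union.1 (hH.maps (h.pairing_mem hDq hT)) with hm | hm
    · obtain ⟨t, ht, e⟩ := (mem_image hL).1 hm
      have hnot : ¬ t ∈ₘ D := fun htD => by
        obtain ⟨-, S, T', ⟨hS, hT'⟩, e', htS⟩ := (hD t).1 htD
        have := (h.pairing_inj hS hT' hDq hT (hH.inj (h.pairing_mem hS hT')
          (h.pairing_mem hDq hT) (e'.trans e.symm))).1
        exact htS (this ▸ htD)
      exact absurd ((hD t).2 ⟨ht, D, T, ⟨hDq, hT⟩, e, hnot⟩) hnot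
    · exact hm
  have hE : Emb (fun T => H (pairing F G D T)) (SetModel.pow q) (image R a) :=
    ⟨hHd.comp (hJ.comp₂ (by fun_prop) (by fun_prop)), fun hT => key _ hT, fun hT hT' e =>
      (h.pairing_inj hDq hT hDq hT' (hH.inj (h.pairing_mem hDq hT) (h.pairing_mem hDq hT') e)).2⟩
  exact ((hR.invOn (c := image R a) fun y hy =>
    let ⟨x, hx, e⟩ := (mem_image hRd).1 hy
    ⟨x, hx, e.symm⟩).comp hE).dominated

theorem equinumerous_or_of_mem_gchClass {x y : M} (hx : x ∈ gchClass M) (hxy : Dominated x y)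
    (hy : Dominated y (pow x)) :
    (∃ n, IsOrdinal n ∧ Dominated x n) ∨ Equinumerous x y ∨ Equinumerous y (pow x) := by
  rcases hx with ⟨n, hn, hxn⟩ | hx
  · exact Or.inl ⟨n, hn.isOrdinal, hxn.dominated⟩
  · have := hx (pow x) (fun _ => mem_pow) y
    unfold StrictlyDominated at this
    tauto

/-- GCH is applied to a union of copies of `q` and `a` inside `𝒫 q`. If it has the size of `q`, then
`a ≼ q`; if that of `𝒫 q`, the diagonal argument gives `q ≼ 𝒫 q ≼ a`. A finite `q` injects into a
natural number. -/
theorem Doubles.dominated_of_dominated_pow {e : M} (h : Doubles F G q) (he : e ∈ₘ q)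
    (hq : q ∈ gchClass M) (ha : IsOrdinal a) (haq : Dominated a (SetModel.pow q)) :
    Dominated a q ∨ ∃ b, IsOrdinal b ∧ Dominated q b := by
  have hp := h.pow he
  obtain ⟨g, hg⟩ := dominated_iff.1 haq
  have hL := hp.left.comp (emb_singleton (a := q))
  have hR := hp.right.comp hg
  set L : M → M := fun x => image F (upair x x)
  set R : M → M := fun x => insert (G e) (image F (g x))
  have hqy : Dominated q (union (image L q) (image R a)) :=
    hL.equinumerous_image.dominated.trans (.of_subset fun z hz => mem_union.2 (Or.inl hz))
  have hay : Dominated a (union (image L q) (image R a)) :=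
    hR.equinumerous_image.dominated.trans (.of_subset fun z hz => mem_union.2 (Or.inr hz))
  have hyp : Dominated (union (image L q) (image R a)) (SetModel.pow q) := by
    refine .of_subset fun z hz => ?_
    rcases mem_union.1 hz with hz | hz
    · obtain ⟨t, ht, rfl⟩ := (mem_image hL.dfn).1 hz
      exact hL.maps ht
    · obtain ⟨t, ht, rfl⟩ := (mem_image hR.dfn).1 hz
      exact hR.maps ht
  rcases equinumerous_or_of_mem_gchClass hq hqy hyp with hn | hqy' | hyp'
  · exact Or.inr hn
  · exact Or.inl (hay.trans hqy'.symm.dominated)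
  · obtain ⟨H, hH⟩ := dominated_iff.1 hyp'.symm.dominated
    exact Or.inr ⟨a, ha, emb_singleton.dominated.trans (h.pow_dominated hL.dfn hR hH)⟩

/-- Under GCH every set injects into an ordinal. -/
theorem exists_ordinal_dominated (hGCH : gchClass M = Set.univ) (x : M) :
    ∃ a, IsOrdinal a ∧ Dominated x a := by
  have hmem : ∀ y : M, y ∈ gchClass M := fun y => hGCH ▸ Set.mem_univ y
  obtain ⟨q, F, G, e, hxq, h, he⟩ := exists_doubles x
  obtain ⟨a, ha, hna, hap⟩ := exists_hartogs q
  have hs : ∀ {y : M}, Dominated y (pow y) := emb_singleton.dominated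
  have h1 := h.pow he
  have he1 : q ∈ₘ pow q := mem_pow.2 fun _ => id
  have h2 := h1.pow he1
  have he2 : pow q ∈ₘ pow (pow q) := mem_pow.2 fun _ => id
  -- Each application removes one power set above `q` or bounds the current set by an ordinal;
  -- removing all three contradicts the choice of `a`.
  rcases h2.dominated_of_dominated_pow he2 (hmem _) ha hap with hap | ⟨b, hb, hqb⟩
  · rcases h1.dominated_of_dominated_pow he1 (hmem _) ha hap with hap | ⟨b, hb, hqb⟩
    · rcases h.dominated_of_dominated_pow he (hmem _) ha hap with hap | ⟨b, hb, hqb⟩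
      · exact absurd hap hna
      · exact ⟨b, hb, hxq.trans hqb⟩
    · exact ⟨b, hb, hxq.trans (hs.trans hqb)⟩
  · exact ⟨b, hb, hxq.trans (hs.trans (hs.trans hqb))⟩

end GCH

/-! ### Cardinals, well-orders and choice -/

section Consequences

variable {x a : M}

theorem mem_domCard_of_equinumerous {c : M} (hc : IsOrdinal c) (h : Equinumerous c x) :
    x ∈ domCard M :=
  ⟨sep c fun z => ∀ a : M, IsOrdinal a → Equinumerous a x → z ∈ₘ a, fun z => by
    rw [mem_sep (by fun_prop)]
    exact ⟨fun h => h.2, fun h' => ⟨h' c hc h, h'⟩⟩⟩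

theorem opair_mem_pow_pow {u v : M} (hu : u ∈ₘ x) (hv : v ∈ₘ x) : opair u v ∈ₘ pow (pow x) := by
  refine mem_pow.2 fun z hz => mem_pow.2 fun t ht => ?_
  rcases mem_upair.1 hz with rfl | rfl <;> rcases mem_upair.1 ht with rfl | rfl <;> assumption

/-- An `∈`-minimal element of the image of `b` is least in it, by linearity of the ordinal, and
pulls back along `F`. -/
theorem exists_min {F : M → M} (ha : IsOrdinal a) (hF : Emb F x a) {b : M} (hb : Subset b x)
    (hne : ∃ y, y ∈ₘ b) : ∃ y, y ∈ₘ b ∧ ∀ z, z ∈ₘ b → z ≠ y → F y ∈ₘ F z := by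
  have hd := hF.dfn
  obtain ⟨y₀, hy₀⟩ := hne
  obtain ⟨m, hm, hmin⟩ := foundation (x := image F b) ⟨F y₀, mem_image_of_mem hd hy₀⟩
  obtain ⟨y, hy, rfl⟩ := (mem_image hd).1 hm
  refine ⟨y, hy, fun z hz hne => ?_⟩
  rcases (isOrdinal_iff.1 ha).2 (F y) (F z) (hF.maps (hb y hy)) (hF.maps (hb z hz)) with h | h | h
  · exact h
  · exact absurd (hF.inj (hb y hy) (hb z hz) h).symm hne
  · exact absurd h (hmin _ (mem_image_of_mem hd hz))

theorem wellOrderable_of_dominated (ha : IsOrdinal a) (h : Dominated x a) : WellOrderable x := by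
  obtain ⟨F, hF⟩ := dominated_iff.1 h
  have hd := hF.dfn
  have hP : Dfn M fun p : M => ∃ u v, p = opair u v ∧ F u ∈ₘ F v := by fun_prop
  -- Kuratowski pairs of elements of `x` lie in `𝒫𝒫x`, so separation yields the order as a set.
  let r := sep (pow (pow x)) fun p => ∃ u v, p = opair u v ∧ F u ∈ₘ F v
  have hr : ∀ {u v : M}, u ∈ₘ x → v ∈ₘ x → (PairMem r u v ↔ F u ∈ₘ F v) := by
    intro u v hu hv
    rw [pairMem_iff, mem_sep hP]
    constructor
    · rintro ⟨-, u', v', e, h⟩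
      obtain ⟨rfl, rfl⟩ := opair_inj.1 e
      exact h
    · exact fun h => ⟨opair_mem_pow_pow hu hv, u, v, rfl, h⟩
  refine ⟨r, fun y hy h => mem_irrefl _ ((hr hy hy).1 h), fun y z t hy hz ht h h' => ?_,
    fun y z hy hz => ?_, fun b hb hne => ?_⟩
  · rw [hr hy ht]
    exact (ha.mem (hF.maps ht)).trans ((hr hy hz).1 h) ((hr hz ht).1 h')
  · rw [hr hy hz, hr hz hy]
    rcases (isOrdinal_iff.1 ha).2 _ _ (hF.maps hy) (hF.maps hz) with h | h | h
    · exact Or.inl h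
    · exact Or.inr (Or.inl (hF.inj hy hz h))
    · exact Or.inr (Or.inr h)
  · obtain ⟨y, hy, hmin⟩ := exists_min ha hF hb hne
    exact ⟨y, hy, fun z hz hzy => (hr (hb y hy) (hb z hz)).2 (hmin z hz hzy)⟩

theorem exists_choice_of_dominated (ha : IsOrdinal a) (h : Dominated (sUnion x) a) :
    ∃ f : M, IsFunctionOn f x ∧
      ∀ z v : M, z ∈ₘ x → (∃ t : M, t ∈ₘ z) → PairMem f z v → v ∈ₘ z := by
  obtain ⟨F, hF⟩ := dominated_iff.1 h
  have hd := hF.dfn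
  -- The least element of `z` in the order pulled back along `F`. For empty `z` the default value is
  -- harmless.
  let C : M → M := fun z => the fun y => y ∈ₘ z ∧ ∀ t, t ∈ₘ z → t ≠ y → F y ∈ₘ F t
  have hC : Dfn M C := by fun_prop
  refine ⟨lam x C, isFunctionOn_lam hC, fun z v hz hne hv => ?_⟩
  obtain ⟨-, rfl⟩ := (pairMem_lam hC).1 hv
  obtain ⟨y, hy, hmin⟩ := exists_min ha hF (fun t ht => mem_sUnion.2 ⟨z, hz, ht⟩) hne
  have : C z = y := the_eq ⟨hy, hmin⟩ fun y' ⟨hy', hmin'⟩ => by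
    by_contra hne
    exact mem_asymm (hmin y' hy' hne) (hmin' y hy (Ne.symm hne))
  rwa [this]

end Consequences

end

end SetModel

/-- In every model of ZF in which every set is a GCH-set, `card` is defined on every set, every set
is well-orderable, and the axiom of choice holds. -/
theorem mainTheorem2 {M : Type*} [SetModel.setLang.Structure M] (hZF : SetModel.IsZFModel M)
    (hGCH : SetModel.gchClass M = Set.univ) :
    SetModel.domCard M = Set.univ ∧ (∀ x : M, SetModel.WellOrderable x) ∧
      SetModel.AxiomOfChoice M := by
  have : SetModel.ZF M := ⟨hZF⟩
  have key := SetModel.exists_ordinal_dominated hGCH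
  refine ⟨Set.eq_univ_of_forall fun x => ?_, fun x => ?_, fun x => ?_⟩
  · obtain ⟨a, ha, hx⟩ := key x
    obtain ⟨c, hc, hcx⟩ := SetModel.exists_ordinal_equinumerous ha hx
    exact SetModel.mem_domCard_of_equinumerous hc hcx
  · obtain ⟨a, ha, hx⟩ := key x
    exact SetModel.wellOrderable_of_dominated ha hx
  · obtain ⟨a, ha, hx⟩ := key (SetModel.sUnion x)
    exact SetModel.exists_choice_of_dominated ha hx
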